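/- Let $\mathcal F$ be a hereditary family of finite subsets of $\mathbb N$ (every subset of a member of $\mathcal F$ is a member of $\mathcal F$) that covers $\mathbb N$. For $x\in\mathbb R^{\mathbb N}$ let $$\|x\|_{\mathcal F}=\sup\Big\{\sum_{k\in F}|x(k)| : F\in\mathcal F\Big\}\in[0,\infty],$$ for $A\subseteq\mathbb N$ let $P_A:\mathbb R^{\mathbb N}\to\mathbb R^{\mathbb N}$ be the coordinate projection onto $A$ (so $P_A(x)(k)=x(k)$ if $k\in A$ and $P_A(x)(k)=0$ otherwise), and let $X_{\mathcal F}$ be the real Banach space $$X_{\mathcal F}=\big\{x\in\mathbb R^{\mathbb N} : \|P_{[n,\infty)}(x)\|_{\mathcal F}\to 0 \text{ as } n\to\infty\big\}$$ equipped with the norm $\|\cdot\|_{\mathcal F}$. Let $\overline{\mathcal F}$ be the closure of $\mathcal F$ in the power set $\mathcal P(\mathbb N)\simeq\{0,1\}^{\mathbb N}$ with the product topology. A block basic sequence in $X_{\mathcal F}$ is a sequence $(x_n)$ of nonzero vectors for which there are natural numbers $p_1<p_2<\cdots$ with $\operatorname{supp}(x_n)\subseteq[p_n,p_{n+1})$ for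 all $n$, where $\operatorname{supp}(x)=\{k:x(k)\neq 0\}$; it is normalized if $\|x_n\|_{\mathcal F}=1$ for all $n$, and $\mathcal F$-supported if $\operatorname{supp}(x_n)\in\mathcal F$ for all $n$. A Banach space has the Schur property if every weakly convergent sequence in it converges in norm to its weak limit. **Theorem.** $X_{\mathcal F}$ has the Schur property if and only if for every $\mathcal F$-supported normalized block basic sequence $(x_n)$ in $X_{\mathcal F}$ there is an $A\in\overline{\mathcal F}$ such that $\limsup_{n\to\infty}\|P_A(x_n)\|_{\mathcal F}>0$. -/

import Mathlib

open Filter Topology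
open scoped ENNReal

/-- `FHC`: a hereditary family of finite subsets of `ℕ` that covers `ℕ`. -/
structure FHC where
  /-- the underlying family of finite sets -/
  sets : Set (Finset ℕ)
  hereditary : ∀ F ∈ sets, ∀ E, E ⊆ F → E ∈ sets
  covers : ∀ k : ℕ, ∃ F ∈ sets, k ∈ F

namespace FHC

/-- The characteristic function of `A`, i.e. the identification of the power set of `ℕ` with the
Cantor space `2^ℕ`. -/
noncomputable def charFun (A : Set ℕ) : ℕ → Bool := by
  classical exact fun k => decide (k ∈ A)

/-- The topological closure of `𝓕` in the power set of `ℕ`, the latter carrying the product topology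
of `2^ℕ` (`Bool` is discrete). -/
def closedFamily (𝓕 : FHC) : Set (Set ℕ) :=
  {A | charFun A ∈ closure ((fun F : Finset ℕ => charFun (F : Set ℕ)) '' 𝓕.sets)}

/-- The extended norm `sup {∑_{k ∈ F} |x k| : F ∈ 𝓕}` on `ℝ^ℕ`. -/
noncomputable def extNorm (𝓕 : FHC) (x : ℕ → ℝ) : ℝ≥0∞ :=
  ⨆ F ∈ 𝓕.sets, ∑ k ∈ F, ENNReal.ofReal |x k|

/-- The coordinate projection `P_A` on `ℝ^ℕ`. -/
noncomputable def coordProj (A : Set ℕ) (x : ℕ → ℝ) : ℕ → ℝ := A.indicator x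

variable (𝓕 : FHC)

theorem extNorm_add_le (x y : ℕ → ℝ) :
    𝓕.extNorm (x + y) ≤ 𝓕.extNorm x + 𝓕.extNorm y := by
  refine iSup₂_le fun F hF => ?_
  calc ∑ k ∈ F, ENNReal.ofReal |(x + y) k|
      ≤ ∑ k ∈ F, (ENNReal.ofReal |x k| + ENNReal.ofReal |y k|) := by
        refine Finset.sum_le_sum fun k _ => ?_
        rw [← ENNReal.ofReal_add (abs_nonneg _) (abs_nonneg _)]
        exact ENNReal.ofReal_le_ofReal (abs_add_le _ _)
    _ = ∑ k ∈ F, ENNReal.ofReal |x k| + ∑ k ∈ F, ENNReal.ofReal |y k| := Finset.sum_add_distrib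
    _ ≤ 𝓕.extNorm x + 𝓕.extNorm y :=
        add_le_add (le_iSup₂_of_le F hF le_rfl) (le_iSup₂_of_le F hF le_rfl)

theorem extNorm_smul (c : ℝ) (x : ℕ → ℝ) :
    𝓕.extNorm (c • x) = ENNReal.ofReal |c| * 𝓕.extNorm x := by
  simp only [extNorm, ENNReal.mul_iSup, Finset.mul_sum, Pi.smul_apply, smul_eq_mul, abs_mul,
    ENNReal.ofReal_mul (abs_nonneg c)]

theorem extNorm_zero : 𝓕.extNorm 0 = 0 := by
  simp [extNorm]

theorem ofReal_abs_le_extNorm (x : ℕ → ℝ) (k : ℕ) : ENNReal.ofReal |x k| ≤ 𝓕.extNorm x := by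
  obtain ⟨F, hF, hk⟩ := 𝓕.covers k
  exact le_iSup₂_of_le F hF
    (Finset.single_le_sum (f := fun k => ENNReal.ofReal |x k|) (fun _ _ => zero_le) hk)

/-- `X_𝓕 = {x ∈ ℝ^ℕ : ‖P_{[n,∞)}(x)‖_𝓕 → 0}` as a linear subspace of `ℝ^ℕ`. -/
noncomputable def exh : Submodule ℝ (ℕ → ℝ) where
  carrier := {x | Tendsto (fun n : ℕ => 𝓕.extNorm (coordProj (Set.Ici n) x)) atTop (𝓝 0)}
  zero_mem' := by
    simp [coordProj, extNorm_zero]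
  add_mem' := by
    intro x y hx hy
    have h := Tendsto.add hx hy
    rw [add_zero] at h
    refine tendsto_of_tendsto_of_tendsto_of_le_of_le tendsto_const_nhds h
      (fun _ => zero_le) fun n => ?_
    simp only [coordProj, Set.indicator_add']
    exact 𝓕.extNorm_add_le _ _
  smul_mem' := by
    intro c x hx
    have h := ENNReal.Tendsto.const_mul (a := ENNReal.ofReal |c|) hx (Or.inr ENNReal.ofReal_ne_top)
    rw [mul_zero] at h
    refine h.congr fun n => ?_
    have : coordProj (Set.Ici n) (c • x) = c • coordProj (Set.Ici n) x := by
      funext k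
      by_cases hk : n ≤ k <;> simp [coordProj, hk]
    rw [this, extNorm_smul]

theorem extNorm_lt_top {x : ℕ → ℝ} (hx : x ∈ 𝓕.exh) : 𝓕.extNorm x < ∞ := by
  have hx' : Tendsto (fun n : ℕ => 𝓕.extNorm (coordProj (Set.Ici n) x)) atTop (𝓝 0) := hx
  obtain ⟨n, hn⟩ := (hx'.eventually (gt_mem_nhds ENNReal.zero_lt_top)).exists
  have hsplit : x = coordProj (Set.Iio n) x + coordProj (Set.Ici n) x := by
    rw [coordProj, coordProj, ← Set.compl_Iio, Set.indicator_self_add_compl]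
  rw [hsplit]
  refine (𝓕.extNorm_add_le _ _).trans_lt (ENNReal.add_lt_top.2 ⟨?_, hn⟩)
  refine lt_of_le_of_lt (b := ∑ k ∈ Finset.range n, ENNReal.ofReal |x k|) ?_
    (ENNReal.sum_lt_top.2 fun _ _ => ENNReal.ofReal_lt_top)
  refine iSup₂_le fun F _ => ?_
  calc ∑ k ∈ F, ENNReal.ofReal |coordProj (Set.Iio n) x k|
      = ∑ k ∈ F, if k < n then ENNReal.ofReal |x k| else 0 := by
        refine Finset.sum_congr rfl fun k _ => ?_
        by_cases hk : k < n <;> simp [coordProj, hk]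
    _ = ∑ k ∈ F with k < n, ENNReal.ofReal |x k| := (Finset.sum_filter _ _).symm
    _ ≤ ∑ k ∈ Finset.range n, ENNReal.ofReal |x k| := by
        refine Finset.sum_le_sum_of_subset fun k hk => ?_
        simpa using (Finset.mem_filter.1 hk).2

/-- The combinatorial space `X_𝓕`. It is a type of its own, so that it carries only the topology of
its norm and not the one inherited from the product `ℝ^ℕ`. -/
def Space : Type := 𝓕.exh

namespace Space

variable {𝓕}

noncomputable instance : AddCommGroup 𝓕.Space := inferInstanceAs (AddCommGroup 𝓕.exh)

noncomputable instance : Module ℝ 𝓕.Space := inferInstanceAs (Module ℝ 𝓕.exh)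

/-- The sequence of coordinates of an element of `X_𝓕`. -/
def coords (x : 𝓕.Space) : ℕ → ℝ := Subtype.val x

noncomputable instance : Norm 𝓕.Space where
  norm x := (𝓕.extNorm x.coords).toReal

theorem norm_def (x : 𝓕.Space) : ‖x‖ = (𝓕.extNorm x.coords).toReal := rfl

theorem extNorm_coords_ne_top (x : 𝓕.Space) : 𝓕.extNorm x.coords ≠ ∞ :=
  (𝓕.extNorm_lt_top (Subtype.property x)).ne

theorem normedCore : NormedSpace.Core ℝ 𝓕.Space where
  norm_nonneg _ := ENNReal.toReal_nonneg
  norm_smul c x := by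
    have h : (c • x).coords = c • x.coords := rfl
    rw [norm_def, norm_def, h, extNorm_smul, ENNReal.toReal_mul,
      ENNReal.toReal_ofReal (abs_nonneg c), Real.norm_eq_abs]
  norm_triangle x y := by
    have h : (x + y).coords = x.coords + y.coords := rfl
    rw [norm_def, norm_def, norm_def, h,
      ← ENNReal.toReal_add (extNorm_coords_ne_top x) (extNorm_coords_ne_top y)]
    exact ENNReal.toReal_mono
      (ENNReal.add_ne_top.2 ⟨extNorm_coords_ne_top x, extNorm_coords_ne_top y⟩)
      (𝓕.extNorm_add_le _ _)
  norm_eq_zero_iff x := by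
    constructor
    · intro h
      rw [norm_def, ENNReal.toReal_eq_zero_iff] at h
      have h0 := h.resolve_right (extNorm_coords_ne_top x)
      refine Subtype.ext (funext fun k => ?_)
      have hk := 𝓕.ofReal_abs_le_extNorm x.coords k
      rw [h0, nonpos_iff_eq_zero, ENNReal.ofReal_eq_zero] at hk
      exact abs_nonpos_iff.1 hk
    · rintro rfl
      have h : (0 : 𝓕.Space).coords = 0 := rfl
      rw [norm_def, h, extNorm_zero, ENNReal.toReal_zero]

noncomputable instance : NormedAddCommGroup 𝓕.Space := NormedAddCommGroup.ofCore normedCore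

noncomputable instance : NormedSpace ℝ 𝓕.Space := NormedSpace.ofCore normedCore

end Space

variable {𝓕}

/-- `(x_n)` is a block basic sequence with respect to the canonical basis `(e_k)` of `X_𝓕`: the `x_n`
are nonzero and supported by successive finite intervals `[p_n, p_{n+1})`. -/
def IsBlockBasic (x : ℕ → 𝓕.Space) : Prop :=
  (∀ n, x n ≠ 0) ∧ ∃ p : ℕ → ℕ, StrictMono p ∧
    ∀ n, Function.support (x n).coords ⊆ Set.Ico (p n) (p (n + 1))

/-- Every `x_n` has its support in the family `𝓕`. -/
def IsFamilySupported (x : ℕ → 𝓕.Space) : Prop :=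
  ∀ n, ∃ F ∈ 𝓕.sets, Function.support (x n).coords = (F : Set ℕ)

end FHC

/-- The Schur property of a real normed space: weakly convergent sequences converge in norm. -/
def SchurProperty (X : Type*) [NormedAddCommGroup X] [NormedSpace ℝ X] : Prop :=
  ∀ (x : ℕ → X) (a : X),
    (∀ f : StrongDual ℝ X, Tendsto (fun n => f (x n)) atTop (𝓝 (f a))) →
      Tendsto x atTop (𝓝 a)

open MeasureTheory in
/-- A uniformly bounded pointwise null sequence of nonnegative continuous functions on a compact
Hausdorff space has convex combinations that are uniformly small. -/
theorem exists_mem_convexHull_forall_lt {K : Type*} [TopologicalSpace K] [CompactSpace K]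
    [T2Space K] (a : ℕ → C(K, ℝ)) {C : ℝ} (h0 : ∀ n t, 0 ≤ a n t) (hC : ∀ n t, a n t ≤ C)
    (h : ∀ t, Tendsto (fun n => a n t) atTop (𝓝 0)) {δ : ℝ} (hδ : 0 < δ) :
    ∃ g ∈ convexHull ℝ (Set.range a), ∀ t, g t < δ := by
  by_contra! hcon
  let S : Set C(K, ℝ) := {g | ∀ t, g t < δ}
  have hSo : IsOpen S := by
    have := ContinuousMap.isOpen_setOfPred_mapsTo (X := K) (Y := ℝ) isCompact_univ
      (isOpen_Iio (a := δ))
    simpa [S, Set.MapsTo] using this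
  have hSc : Convex ℝ S := by
    intro g hg g' hg' s t hs ht hst x
    exact convex_Iio δ (hg x) (hg' x) hs ht hst
  obtain ⟨Λ, u, hlt, hle⟩ := geometric_hahn_banach_open hSc hSo (convex_convexHull ℝ (Set.range a))
    (Set.disjoint_left.2 fun g hg hg' => by
      obtain ⟨t, ht⟩ := hcon g hg'
      exact absurd (hg t) (not_lt.2 ht))
  have hu : 0 < u := by simpa using hlt 0 fun _ => hδ
  have hpos : ∀ g : C(K, ℝ), 0 ≤ g → 0 ≤ Λ g := by
    intro g hg
    by_contra! hneg
    have hmem : (u / Λ g) • g ∈ S := fun t => by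
      have h1 : u / Λ g * g t ≤ 0 :=
        mul_nonpos_of_nonpos_of_nonneg (div_nonpos_of_nonneg_of_nonpos hu.le hneg.le) (hg t)
      simpa using h1.trans_lt hδ
    have := hlt _ hmem
    rw [map_smul, smul_eq_mul, div_mul_cancel₀ _ hneg.ne] at this
    exact this.false
  let _ : MeasurableSpace K := borel K
  have : BorelSpace K := ⟨rfl⟩
  let L : CompactlySupportedContinuousMap K ℝ →ₗ[ℝ] ℝ :=
    { toFun := fun g => Λ g.toContinuousMap
      map_add' := fun g g' => map_add Λ g.toContinuousMap g'.toContinuousMap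
      map_smul' := fun c g => map_smul Λ c g.toContinuousMap }
  let Φ : CompactlySupportedContinuousMap K ℝ →ₚ[ℝ] ℝ :=
    PositiveLinearMap.mk₀ L fun g hg => hpos _ fun t => hg t
  have hint : ∀ n, u ≤ ∫ t, a n t ∂(RealRMK.rieszMeasure Φ) := by
    intro n
    have := RealRMK.integral_rieszMeasure Φ
      (CompactlySupportedContinuousMap.continuousMapEquiv (a n))
    refine (hle _ (subset_convexHull ℝ _ ⟨n, rfl⟩)).trans_eq this.symm
  have hlim : Tendsto (fun n => ∫ t, a n t ∂(RealRMK.rieszMeasure Φ)) atTop (𝓝 0) := by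
    have := tendsto_integral_of_dominated_convergence (μ := RealRMK.rieszMeasure Φ)
      (F := fun n t => a n t) (f := fun _ => (0 : ℝ)) (fun _ => C)
      (fun n => (a n).continuous.aestronglyMeasurable) (integrable_const C)
      (fun n => Eventually.of_forall fun t => by
        rw [Real.norm_eq_abs, abs_of_nonneg (h0 n t)]; exact hC n t)
      (Eventually.of_forall h)
    simpa using this
  exact absurd (ge_of_tendsto' hlim hint) (not_le.2 hu)

namespace FHC

variable {𝓕 : FHC}

theorem mem_sets_of_subset_of_mem_closedFamily {A : Set ℕ} (hA : A ∈ 𝓕.closedFamily)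
    {s : Finset ℕ} (hs : (s : Set ℕ) ⊆ A) : s ∈ 𝓕.sets := by
  have hopen : IsOpen {g : ℕ → Bool | ∀ k ∈ s, g k = true} := by
    have : {g : ℕ → Bool | ∀ k ∈ s, g k = true} = ⋂ k ∈ s, (fun g => g k) ⁻¹' {true} := by
      ext g; simp
    rw [this]
    exact isOpen_biInter_finset fun k _ => (isOpen_discrete _).preimage (continuous_apply k)
  obtain ⟨_, hg, F, hF, rfl⟩ := mem_closure_iff.1 hA _ hopen fun k hk => by
    simpa [charFun] using hs hk
  refine 𝓕.hereditary F hF s fun k hk => ?_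
  simpa [charFun] using hg k hk

theorem coe_mem_closedFamily {F : Finset ℕ} (hF : F ∈ 𝓕.sets) : (F : Set ℕ) ∈ 𝓕.closedFamily :=
  subset_closure ⟨F, hF, rfl⟩

theorem extNorm_mono {x y : ℕ → ℝ} (h : ∀ k, |x k| ≤ |y k|) : 𝓕.extNorm x ≤ 𝓕.extNorm y :=
  iSup₂_mono fun _ _ => Finset.sum_le_sum fun k _ => ENNReal.ofReal_le_ofReal (h k)

theorem abs_coordProj_le (A : Set ℕ) (x : ℕ → ℝ) (k : ℕ) : |coordProj A x k| ≤ |x k| := by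
  by_cases hk : k ∈ A <;> simp [coordProj, hk]

theorem extNorm_coordProj_le (A : Set ℕ) (x : ℕ → ℝ) :
    𝓕.extNorm (coordProj A x) ≤ 𝓕.extNorm x :=
  extNorm_mono (abs_coordProj_le A x)

theorem mem_exh_of_abs_le {x y : ℕ → ℝ} (hy : y ∈ 𝓕.exh) (h : ∀ k, |x k| ≤ |y k|) :
    x ∈ 𝓕.exh := by
  refine tendsto_of_tendsto_of_tendsto_of_le_of_le tendsto_const_nhds
    (show Tendsto (fun n : ℕ => 𝓕.extNorm (coordProj (Set.Ici n) y)) atTop (𝓝 0) from hy)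
    (fun _ => zero_le) fun n => extNorm_mono fun k => ?_
  by_cases hk : n ≤ k <;> simp [coordProj, hk, h k]

namespace Space

theorem ofReal_norm_eq (x : 𝓕.Space) : ENNReal.ofReal ‖x‖ = 𝓕.extNorm x.coords :=
  ENNReal.ofReal_toReal (extNorm_coords_ne_top x)

theorem norm_le_of_forall_sum_le {x : 𝓕.Space} {c : ℝ} (hc : 0 ≤ c)
    (h : ∀ F ∈ 𝓕.sets, ∑ k ∈ F, |x.coords k| ≤ c) : ‖x‖ ≤ c := by
  refine ENNReal.toReal_le_of_le_ofReal hc (iSup₂_le fun F hF => ?_)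
  rw [← ENNReal.ofReal_sum_of_nonneg fun _ _ => abs_nonneg _]
  exact ENNReal.ofReal_le_ofReal (h F hF)

theorem sum_abs_le_norm (x : 𝓕.Space) {F : Finset ℕ} (hF : F ∈ 𝓕.sets) :
    ∑ k ∈ F, |x.coords k| ≤ ‖x‖ := by
  rw [← ENNReal.ofReal_le_ofReal_iff (norm_nonneg x), ofReal_norm_eq,
    ENNReal.ofReal_sum_of_nonneg fun _ _ => abs_nonneg _]
  exact le_iSup₂_of_le (f := fun F (_ : F ∈ 𝓕.sets) => ∑ k ∈ F, ENNReal.ofReal |x.coords k|)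
    F hF le_rfl

theorem abs_coords_le_norm (x : 𝓕.Space) (k : ℕ) : |x.coords k| ≤ ‖x‖ := by
  obtain ⟨F, hF, hk⟩ := 𝓕.covers k
  simpa using x.sum_abs_le_norm (𝓕.hereditary F hF {k} (by simpa using hk))

theorem coords_add (x y : 𝓕.Space) : (x + y).coords = x.coords + y.coords := rfl

theorem coords_smul (c : ℝ) (x : 𝓕.Space) : (c • x).coords = c • x.coords := rfl

theorem coords_injective : Function.Injective (coords : 𝓕.Space → ℕ → ℝ) :=
  Subtype.val_injective

/-- The coordinate projection `P_A` as a self-map of `X_𝓕`. -/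
noncomputable def proj (A : Set ℕ) (x : 𝓕.Space) : 𝓕.Space :=
  ⟨coordProj A x.coords, mem_exh_of_abs_le (Subtype.property x) (abs_coordProj_le A _)⟩

theorem coords_proj (A : Set ℕ) (x : 𝓕.Space) : (proj A x).coords = coordProj A x.coords := rfl

/-- A bounded sequence of finitely supported vectors of `X_𝓕` is weakly null if its projections
onto every member of the closure of `𝓕` tend to zero. -/
theorem tendsto_dual_of_tendsto_extNorm_coordProj (x : ℕ → 𝓕.Space)
    (hfin : ∀ n, (Function.support (x n).coords).Finite) {C : ℝ} (hC : ∀ n, ‖x n‖ ≤ C)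
    (h : ∀ A ∈ 𝓕.closedFamily,
      Tendsto (fun n => 𝓕.extNorm (coordProj A (x n).coords)) atTop (𝓝 0))
    (f : StrongDual ℝ 𝓕.Space) : Tendsto (fun n => f (x n)) atTop (𝓝 0) := by
  let K : Set (ℕ → Bool) := closure ((fun F : Finset ℕ => charFun (F : Set ℕ)) '' 𝓕.sets)
  have : CompactSpace K := isCompact_iff_compactSpace.1 isClosed_closure.isCompact
  let a : ℕ → C(K, ℝ) := fun n =>
    ⟨fun g => ∑ k ∈ (hfin n).toFinset, if g.1 k = true then |(x n).coords k| else 0,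
      continuous_finsetSum _ fun k _ =>
        (continuous_of_discreteTopology
          (f := fun b : Bool => if b = true then |(x n).coords k| else 0)).comp
          ((continuous_apply k).comp continuous_subtype_val)⟩
  have ha0 : ∀ n g, 0 ≤ a n g := fun n g =>
    Finset.sum_nonneg fun k _ => by split_ifs <;> simp
  have hK : ∀ g : K, {k | g.1 k = true} ∈ 𝓕.closedFamily := fun g => by
    have : charFun {k | g.1 k = true} = g.1 := by
      funext k; simp [charFun]
    change charFun _ ∈ K
    rw [this]; exact g.2
  have haP : ∀ n g, a n g ≤ ‖proj {k | g.1 k = true} (x n)‖ := fun n g => by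
    refine le_trans (le_of_eq ?_) (sum_abs_le_norm _ (mem_sets_of_subset_of_mem_closedFamily (hK g)
      (s := (hfin n).toFinset.filter fun k => g.1 k = true) fun k hk => by simp_all))
    rw [Finset.sum_filter]
    refine Finset.sum_congr rfl fun k _ => ?_
    by_cases hk : g.1 k = true <;> simp [coords_proj, coordProj, hk]
  have haC : ∀ n g, a n g ≤ C := fun n g => (haP n g).trans <| by
    refine le_trans ?_ (hC n)
    exact ENNReal.toReal_mono (extNorm_coords_ne_top _) (extNorm_coordProj_le _ _)
  have ha : ∀ g, Tendsto (fun n => a n g) atTop (𝓝 0) := fun g => by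
    have := (ENNReal.tendsto_toReal ENNReal.zero_ne_top).comp (h _ (hK g))
    exact squeeze_zero (fun n => ha0 n g) (fun n => haP n g) this
  rw [Metric.tendsto_atTop]
  by_contra! hcon
  obtain ⟨ε, hε, hN⟩ := hcon
  obtain ⟨φ, hφ, hf⟩ := extraction_of_frequently_atTop (frequently_atTop.2 hN)
  set δ := ε / (‖f‖ + 1) with hδ
  have hf1 : 0 < ‖f‖ + 1 := by positivity
  have hδ0 : 0 < δ := by positivity
  obtain ⟨g, hg, hgδ⟩ := exists_mem_convexHull_forall_lt (fun n => a (φ n))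
    (fun n => ha0 _) (fun n => haC _) (fun t => (ha t).comp hφ.tendsto_atTop) hδ0
  have hsub : convexHull ℝ (Set.range fun n => a (φ n)) ⊆
      {g | ∃ v : 𝓕.Space, ε ≤ f v ∧ ∀ F (hF : F ∈ 𝓕.sets),
        ∑ k ∈ F, |v.coords k| ≤ g ⟨charFun F, coe_mem_closedFamily hF⟩} := by
    refine convexHull_min ?_ ?_
    · rintro _ ⟨n, rfl⟩
      have key : ∀ F (hF : F ∈ 𝓕.sets), ∑ k ∈ F, |(x (φ n)).coords k| ≤
          a (φ n) ⟨charFun F, coe_mem_closedFamily hF⟩ := fun F hF => by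
        simp only [a, charFun, ContinuousMap.coe_mk, Finset.mem_coe, decide_eq_true_eq]
        rw [← Finset.sum_filter, ← Finset.sum_filter_ne_zero]
        refine Finset.sum_le_sum_of_subset_of_nonneg (fun k hk => ?_) fun k _ _ => abs_nonneg _
        simp_all
      have hfn := hf n
      rw [Real.dist_eq, sub_zero] at hfn
      rcases le_abs.1 hfn with h1 | h1
      · exact ⟨x (φ n), h1, key⟩
      · refine ⟨(-1 : ℝ) • x (φ n), by simpa using h1, fun F hF => ?_⟩
        simpa only [coords_smul, Pi.smul_apply, smul_eq_mul, neg_one_mul, abs_neg] using key F hF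
    · rintro g ⟨v, hv, hvF⟩ g' ⟨v', hv', hvF'⟩ s t hs ht hst
      refine ⟨s • v + t • v', ?_, fun F hF => ?_⟩
      · simp only [map_add, map_smul, smul_eq_mul]
        calc ε = s * ε + t * ε := by rw [← add_mul, hst, one_mul]
          _ ≤ _ := by gcongr
      · calc ∑ k ∈ F, |(s • v + t • v').coords k|
            ≤ ∑ k ∈ F, (s * |v.coords k| + t * |v'.coords k|) := by
              refine Finset.sum_le_sum fun k _ => ?_
              rw [← abs_of_nonneg hs, ← abs_of_nonneg ht, ← abs_mul, ← abs_mul,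
                abs_of_nonneg hs, abs_of_nonneg ht]
              exact abs_add_le _ _
          _ = s * ∑ k ∈ F, |v.coords k| + t * ∑ k ∈ F, |v'.coords k| := by
              rw [Finset.sum_add_distrib, Finset.mul_sum, Finset.mul_sum]
          _ ≤ _ := by
              simp only [ContinuousMap.add_apply, ContinuousMap.smul_apply, smul_eq_mul]
              gcongr
              exacts [hvF F hF, hvF' F hF]
  obtain ⟨v, hv, hvF⟩ := hsub hg
  have hvδ : ‖v‖ ≤ δ := norm_le_of_forall_sum_le hδ0.le fun F hF => (hvF F hF).trans (hgδ _).le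
  have h1 : f v ≤ ‖f‖ * δ := (le_abs_self _).trans <| (f.le_opNorm v).trans <| by gcongr
  have h2 : (‖f‖ + 1) * δ = ε := by rw [hδ]; field_simp
  linarith

end Space

end FHC

/-- A single sequence of signs matching prescribed vectors on successive intervals. -/
theorem exists_sign_on_Ico {p : ℕ → ℕ} (hp : StrictMono p) (u : ℕ → ℕ → ℝ) :
    ∃ σ : ℕ → ℝ, (∀ k, |σ k| ≤ 1) ∧
      ∀ n, ∀ k ∈ Set.Ico (p n) (p (n + 1)), σ k * u n k = |u n k| := by
  classical
  refine ⟨fun k => if h : ∃ n, k ∈ Set.Ico (p n) (p (n + 1)) then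
    (SignType.sign (u h.choose k) : ℝ) else 0, fun k => ?_, fun n k hk => ?_⟩
  · dsimp only
    split_ifs with h
    · rcases SignType.sign (u h.choose k) with _ | _ | _ <;> simp
    · simp
  · have h : ∃ n, k ∈ Set.Ico (p n) (p (n + 1)) := ⟨n, hk⟩
    have hn : h.choose = n := by
      by_contra hne
      exact Set.disjoint_left.1 (hp.monotone.pairwise_disjoint_on_Ico_succ hne) h.choose_spec hk
    dsimp only
    rw [dif_pos h, hn, sign_mul_self]

namespace FHC

variable {𝓕 : FHC}

namespace Space

theorem proj_add_proj_add_proj (x : 𝓕.Space) {p q : ℕ} (hpq : p ≤ q) :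
    proj (Set.Iio p) x + proj (Set.Ico p q) x + proj (Set.Ici q) x = x := by
  refine coords_injective (funext fun k => ?_)
  simp only [coords_add, coords_proj, coordProj, Pi.add_apply, Set.indicator_apply, Set.mem_Iio,
    Set.mem_Ico, Set.mem_Ici]
  split_ifs <;> first | omega | simp

theorem tendsto_norm_proj_Ici (x : 𝓕.Space) :
    Tendsto (fun n : ℕ => ‖proj (Set.Ici n) x‖) atTop (𝓝 0) := by
  have h : Tendsto (fun n : ℕ => 𝓕.extNorm (coordProj (Set.Ici n) x.coords)) atTop (𝓝 0) :=
    Subtype.property x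
  exact (ENNReal.tendsto_toReal ENNReal.zero_ne_top).comp h

theorem norm_le_sum_of_support_subset {x : 𝓕.Space} {s : Finset ℕ}
    (h : Function.support x.coords ⊆ s) : ‖x‖ ≤ ∑ k ∈ s, |x.coords k| := by
  refine norm_le_of_forall_sum_le (Finset.sum_nonneg fun _ _ => abs_nonneg _) fun F _ => ?_
  rw [← Finset.sum_filter_ne_zero]
  refine Finset.sum_le_sum_of_subset_of_nonneg (fun k hk => h ?_) fun _ _ _ => abs_nonneg _
  simpa using (Finset.mem_filter.1 hk).2

/-- Every `A` in the closure of `𝓕` and every choice `σ` of coefficients of modulus at most one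
define a functional `∑_{k ∈ A} σ_k e_k^*` of norm at most one. -/
theorem exists_dual_eq_sum {A : Set ℕ} (hA : A ∈ 𝓕.closedFamily) {σ : ℕ → ℝ}
    (hσ : ∀ k, |σ k| ≤ 1) :
    ∃ f : StrongDual ℝ 𝓕.Space, (∀ y, |f y| ≤ ‖y‖) ∧
      ∀ (y : 𝓕.Space) (s : Finset ℕ), Function.support y.coords ⊆ s →
        f y = ∑ k ∈ s, A.indicator σ k * y.coords k := by
  classical
  have hsum : ∀ (y : 𝓕.Space) (s : Finset ℕ),
      ∑ k ∈ s, |A.indicator σ k * y.coords k| ≤ ‖y‖ := fun y s => by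
    refine le_trans ?_ (y.sum_abs_le_norm (mem_sets_of_subset_of_mem_closedFamily hA
      (s := s.filter (· ∈ A)) fun k hk => by simp_all))
    rw [Finset.sum_filter]
    refine Finset.sum_le_sum fun k _ => ?_
    by_cases hk : k ∈ A
    · simpa [hk, abs_mul] using mul_le_of_le_one_left (abs_nonneg _) (hσ k)
    · simp [hk]
  have hsm : ∀ y : 𝓕.Space, Summable fun k => |A.indicator σ k * y.coords k| := fun y =>
    summable_of_sum_le (fun _ => abs_nonneg _) (hsum y)
  let L : 𝓕.Space →ₗ[ℝ] ℝ :=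
    { toFun := fun y => ∑' k, A.indicator σ k * y.coords k
      map_add' := fun y z => by
        rw [← (hsm y).of_abs.tsum_add (hsm z).of_abs]
        exact tsum_congr fun k => mul_add _ _ _
      map_smul' := fun c y => by
        rw [RingHom.id_apply, smul_eq_mul, ← tsum_mul_left]
        exact tsum_congr fun k => mul_left_comm _ _ _ }
  have hL : ∀ y, |L y| ≤ ‖y‖ := fun y => by
    have h1 : |L y| ≤ ∑' k, |A.indicator σ k * y.coords k| :=
      norm_tsum_le_tsum_norm (f := fun k => A.indicator σ k * y.coords k) (hsm y)
    exact h1.trans ((hsm y).tsum_le_of_sum_le (hsum y))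
  refine ⟨L.mkContinuous 1 fun y => (hL y).trans_eq (one_mul _).symm, fun y => ?_,
    fun y s hs => ?_⟩
  · rw [LinearMap.mkContinuous_apply]
    exact hL y
  rw [LinearMap.mkContinuous_apply]
  refine tsum_eq_sum fun k hk => ?_
  rw [Function.notMem_support.1 fun h => hk (hs h), mul_zero]

end Space

open Space

/-- The gliding hump: a weakly null sequence that is not norm null contains, up to vanishing errors,
a sequence of humps on successive intervals. -/
theorem exists_gliding_hump {v : ℕ → 𝓕.Space} {ε : ℝ}
    (hv : ∀ k, Tendsto (fun n => (v n).coords k) atTop (𝓝 0))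
    (hfreq : ∃ᶠ n in atTop, ε ≤ ‖v n‖) {η : ℕ → ℝ} (hη : ∀ n, 0 < η n) :
    ∃ p m : ℕ → ℕ, StrictMono p ∧ ∀ n, n ≤ m n ∧ ε ≤ ‖v (m n)‖ ∧
      ‖proj (Set.Iio (p n)) (v (m n))‖ < η n ∧ ‖proj (Set.Ici (p (n + 1))) (v (m n))‖ < η n := by
  have step : ∀ p n : ℕ, ∃ m q : ℕ, p < q ∧ n ≤ m ∧ ε ≤ ‖v m‖ ∧
      ‖proj (Set.Iio p) (v m)‖ < η n ∧ ‖proj (Set.Ici q) (v m)‖ < η n := by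
    intro p n
    have hlim : Tendsto (fun m => ∑ k ∈ Finset.range p, |(v m).coords k|) atTop (𝓝 0) := by
      simpa using tendsto_finsetSum (Finset.range p) fun k _ => (hv k).abs
    have hlim' : Tendsto (fun m => ‖proj (Set.Iio p) (v m)‖) atTop (𝓝 0) := by
      refine squeeze_zero (fun _ => norm_nonneg _) (fun m => ?_) hlim
      refine (norm_le_sum_of_support_subset (s := Finset.range p) ?_).trans
        (Finset.sum_le_sum fun k _ => abs_coordProj_le _ _ k)
      rw [Finset.coe_range]
      exact Set.support_indicator_subset
    obtain ⟨m, hm, hm1, hm2⟩ := (hfreq.and_eventually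
      ((hlim'.eventually_lt_const (hη n)).and (eventually_ge_atTop n))).exists
    obtain ⟨q, hq1, hq2⟩ := (((tendsto_norm_proj_Ici (v m)).eventually_lt_const (hη n)).and
      (eventually_gt_atTop p)).exists
    exact ⟨m, q, hq2, hm2, hm, hm1, hq1⟩
  choose M Q h1 h2 h3 h4 h5 using step
  let p : ℕ → ℕ := fun n => Nat.rec 0 (fun n p => Q p n) n
  exact ⟨p, fun n => M (p n) n, strictMono_nat_of_lt_succ fun n => h1 (p n) n,
    fun n => ⟨h2 _ _, h3 _ _, h4 _ _, h5 (p n) n⟩⟩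

/-- Every vector of norm greater than `c` has a restriction, to a member of `𝓕` contained in its
support, of norm greater than `c`. -/
theorem exists_norm_proj_gt {z : 𝓕.Space} {c : ℝ} (hc : 0 ≤ c) (hz : c < ‖z‖) :
    ∃ E ∈ 𝓕.sets, Function.support (proj (E : Set ℕ) z).coords = (E : Set ℕ) ∧
      c < ‖proj (E : Set ℕ) z‖ := by
  obtain ⟨F, hF, hFz⟩ : ∃ F ∈ 𝓕.sets, c < ∑ k ∈ F, |z.coords k| := by
    by_contra! h
    exact absurd (norm_le_of_forall_sum_le hc h) (not_le.2 hz)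
  have hE := 𝓕.hereditary F hF (F.filter fun k => z.coords k ≠ 0) (Finset.filter_subset _ _)
  refine ⟨_, hE, ?_, hFz.trans_le ?_⟩
  · ext k
    simp [coords_proj, coordProj]
  · refine le_trans (le_of_eq ?_) (sum_abs_le_norm _ hE)
    rw [Finset.sum_filter]
    refine Finset.sum_congr rfl fun k hk => ?_
    by_cases h : z.coords k = 0 <;> simp [coords_proj, coordProj, h, hk]

theorem schurProperty_of_exists_limsup_pos
    (H : ∀ x : ℕ → 𝓕.Space, IsBlockBasic x → (∀ n, ‖x n‖ = 1) → IsFamilySupported x →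
      ∃ A ∈ 𝓕.closedFamily,
        0 < limsup (fun n => 𝓕.extNorm (coordProj A (x n).coords)) atTop) :
    SchurProperty 𝓕.Space := by
  intro y a hw
  let v : ℕ → 𝓕.Space := fun n => y n - a
  have hv : ∀ f : StrongDual ℝ 𝓕.Space, Tendsto (fun n => f (v n)) atTop (𝓝 0) := fun f => by
    simpa [v] using (hw f).sub_const (f a)
  rw [Metric.tendsto_atTop]
  by_contra! hcon
  obtain ⟨ε, hε, hN⟩ := hcon
  have hfreq : ∃ᶠ n in atTop, ε ≤ ‖v n‖ := frequently_atTop.2 fun N => by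
    simpa [v, dist_eq_norm] using hN N
  have hcoord : ∀ k, Tendsto (fun n => (v n).coords k) atTop (𝓝 0) := fun k => by
    let e : 𝓕.Space →ₗ[ℝ] ℝ :=
      { toFun := fun x => x.coords k
        map_add' := fun _ _ => rfl
        map_smul' := fun _ _ => rfl }
    exact hv (e.mkContinuous 1 fun x => by rw [one_mul]; exact x.abs_coords_le_norm k)
  let η : ℕ → ℝ := fun n => ε / 4 * (1 / ((n : ℝ) + 1))
  have hη : ∀ n, 0 < η n := fun n => by positivity
  have hη4 : ∀ n, η n ≤ ε / 4 := fun n => by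
    refine mul_le_of_le_one_right (by positivity) ?_
    rw [div_le_one (by positivity)]
    simp
  have hηlim : Tendsto η atTop (𝓝 0) := by
    simpa [η] using (tendsto_one_div_add_atTop_nhds_zero_nat (𝕜 := ℝ)).const_mul (ε / 4)
  obtain ⟨p, m, hp, hpm⟩ := exists_gliding_hump hcoord hfreq hη
  choose hm hnorm hhead htail using hpm
  let z : ℕ → 𝓕.Space := fun n => proj (Set.Ico (p n) (p (n + 1))) (v (m n))
  have hsplit : ∀ n, proj (Set.Iio (p n)) (v (m n)) + z n + proj (Set.Ici (p (n + 1))) (v (m n))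
      = v (m n) := fun n => proj_add_proj_add_proj _ (hp.monotone n.le_succ)
  have hz : ∀ n, ε / 4 < ‖z n‖ := fun n => by
    have h1 := norm_add₃_le (a := proj (Set.Iio (p n)) (v (m n))) (b := z n)
      (c := proj (Set.Ici (p (n + 1))) (v (m n)))
    rw [hsplit] at h1
    linarith [hnorm n, hhead n, htail n, hη4 n]
  choose E hE hsupp hEz using fun n => exists_norm_proj_gt (by positivity) (hz n)
  let w : ℕ → 𝓕.Space := fun n => proj (E n : Set ℕ) (z n)
  have hw0 : ∀ n, 0 < ‖w n‖ := fun n => (by positivity : 0 < ε / 4).trans (hEz n)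
  let x : ℕ → 𝓕.Space := fun n => ‖w n‖⁻¹ • w n
  have hx1 : ∀ n, ‖x n‖ = 1 := fun n => by
    simp only [x, norm_smul, norm_inv, norm_norm]
    exact inv_mul_cancel₀ (hw0 n).ne'
  have hxsupp : ∀ n, Function.support (x n).coords = (E n : Set ℕ) := fun n => by
    rw [← hsupp n]
    exact Function.support_const_smul_of_ne_zero _ _ (inv_ne_zero (hw0 n).ne')
  have hzsupp : ∀ n, Function.support (z n).coords ⊆ Set.Ico (p n) (p (n + 1)) := fun n =>
    Set.support_indicator_subset
  have hEsub : ∀ n, (E n : Set ℕ) ⊆ Function.support (z n).coords := fun n => by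
    rw [← hsupp n, coords_proj, coordProj, Set.support_indicator]
    exact Set.inter_subset_right
  obtain ⟨A, hA, hlimsup⟩ := H x
    ⟨fun n h => by simpa [h] using hx1 n, p, hp, fun n =>
      (hxsupp n).trans_subset ((hEsub n).trans (hzsupp n))⟩
    hx1 fun n => ⟨E n, hE n, hxsupp n⟩
  obtain ⟨σ, hσ, hσv⟩ := exists_sign_on_Ico hp fun n => (z n).coords
  obtain ⟨f, hf, hfs⟩ := exists_dual_eq_sum hA hσ
  have hfz : ∀ n, f (z n) =
      ∑ k ∈ Finset.Ico (p n) (p (n + 1)), |coordProj A (z n).coords k| := fun n => by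
    rw [hfs (z n) (Finset.Ico (p n) (p (n + 1))) (by simpa using hzsupp n)]
    refine Finset.sum_congr rfl fun k hk => ?_
    by_cases hkA : k ∈ A
    · simpa [coordProj, hkA] using hσv n k (by simpa using hk)
    · simp [coordProj, hkA]
  have hfz_le : ∀ n, f (z n) ≤ |f (v (m n))| + 2 * η n := fun n => by
    have h1 := congrArg f (hsplit n)
    rw [map_add, map_add] at h1
    have h2 := (neg_le_abs _).trans (hf (proj (Set.Iio (p n)) (v (m n))))
    have h3 := (neg_le_abs _).trans (hf (proj (Set.Ici (p (n + 1))) (v (m n))))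
    linarith [le_abs_self (f (v (m n))), hhead n, htail n]
  have hbound : Tendsto (fun n => 4 / ε * (|f (v (m n))| + 2 * η n)) atTop (𝓝 0) := by
    have h1 := ((hv f).comp (tendsto_atTop_mono hm tendsto_id)).abs
    simpa using (h1.add (hηlim.const_mul 2)).const_mul (4 / ε)
  have hproj : ∀ n, ‖proj A (x n)‖ ≤ 4 / ε * (|f (v (m n))| + 2 * η n) := fun n => by
    have hinv : ‖w n‖⁻¹ ≤ 4 / ε := by
      rw [← inv_div]
      exact inv_anti₀ (by positivity) (hEz n).le
    have hpt : ∀ k, |(proj A (x n)).coords k| ≤ 4 / ε * |coordProj A (z n).coords k| := fun k => by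
      by_cases hkA : k ∈ A
      · have h1 : |(x n).coords k| = ‖w n‖⁻¹ * |(w n).coords k| := by
          have h2 := abs_mul ‖w n‖⁻¹ ((w n).coords k)
          rwa [abs_of_nonneg (inv_nonneg.2 (hw0 n).le)] at h2
        simp only [coords_proj, coordProj, Set.indicator_of_mem hkA, h1]
        exact mul_le_mul hinv (abs_coordProj_le _ _ k) (abs_nonneg _) (by positivity)
      · simp [coords_proj, coordProj, hkA]
    calc ‖proj A (x n)‖
        ≤ ∑ k ∈ Finset.Ico (p n) (p (n + 1)), |(proj A (x n)).coords k| := by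
          refine norm_le_sum_of_support_subset ?_
          rw [coords_proj, coordProj, Set.support_indicator, Finset.coe_Ico, hxsupp]
          exact Set.inter_subset_right.trans ((hEsub n).trans (hzsupp n))
      _ ≤ 4 / ε * f (z n) := by
          rw [hfz, Finset.mul_sum]
          exact Finset.sum_le_sum fun k _ => hpt k
      _ ≤ _ := by
          gcongr
          exact hfz_le n
  have hnull : Tendsto (fun n => 𝓕.extNorm (coordProj A (x n).coords)) atTop (𝓝 0) := by
    have h1 := (ENNReal.continuous_ofReal.tendsto 0).comp
      (squeeze_zero (fun _ => norm_nonneg _) hproj hbound)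
    rw [ENNReal.ofReal_zero] at h1
    exact h1.congr fun n => ofReal_norm_eq (proj A (x n))
  exact hlimsup.ne' hnull.limsup_eq

theorem exists_limsup_pos_of_schurProperty (hS : SchurProperty 𝓕.Space) {x : ℕ → 𝓕.Space}
    (hfin : ∀ n, (Function.support (x n).coords).Finite) (hx : ∀ n, ‖x n‖ = 1) :
    ∃ A ∈ 𝓕.closedFamily,
      0 < limsup (fun n => 𝓕.extNorm (coordProj A (x n).coords)) atTop := by
  by_contra! h
  have hweak := tendsto_dual_of_tendsto_extNorm_coordProj x hfin (fun n => (hx n).le)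
    fun A hA => tendsto_of_le_liminf_of_limsup_le zero_le (h A hA)
  have := (hS x 0 fun f => by simpa using hweak f).norm
  simp only [hx, norm_zero] at this
  exact one_ne_zero (tendsto_nhds_unique tendsto_const_nhds this)

end FHC

theorem mainTheorem7 (𝓕 : FHC) :
    SchurProperty 𝓕.Space ↔
      ∀ x : ℕ → 𝓕.Space, FHC.IsBlockBasic x → (∀ n, ‖x n‖ = 1) → FHC.IsFamilySupported x →
        ∃ A ∈ 𝓕.closedFamily,
          0 < limsup (fun n => 𝓕.extNorm (FHC.coordProj A (x n).coords)) atTop := by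
  refine ⟨fun hS x _ hx hsupp => FHC.exists_limsup_pos_of_schurProperty hS (fun n => ?_) hx,
    FHC.schurProperty_of_exists_limsup_pos⟩
  obtain ⟨F, _, hF⟩ := hsupp n
  rw [hF]
  exact F.finite_toSet
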